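/- **Setting.** There are $n$ jobs and $m$ identical machines. Job $j$ is Bernoulli: its processing time $X_j$ equals $s_j\ge 0$ with probability $p_j\in[0,1]$ and $0$ otherwise, independently across jobs. An adaptive policy schedules all jobs non-preemptively; over time it decides which job to start next, on which free machine and when (idling is allowed), knowing the distributions of all jobs and the realized processing times of the jobs started so far (a Bernoulli job reveals its processing time upon being started). The cost of a policy is its expected total completion time $\mathbb E\sum_j C_j$. A list schedule is given by a fixed ordering of the jobs: whenever a machine is free, it starts the next job of the ordering. **Algorithm StochFree.** For $k=1,\dots,\lfloor\log_2 n\rfloor$ let $J_k$ be obtained from the set $J$ of all jobs by removing, for each size parameter $s$, the $\lfloor n/2^k\rfloor$ jobs $j$ with $s_j=s$ having the largest $p_j$ (all of them, if there are fewer; ties are broken according to a fixed ordering of the jobs by $p_j$), and let $J_0=\emptyset$. List-schedule the batches $J_k\setminus J_{k-1}$, $k=1,\dots,\lfloor\log_2 n\rfloor$, one after the other, each in increasing order of the size parameters $s_j$ (ties broken arbitrarily), and then list-schedule the remaining jobs in arbitrary order. **Lemma 4.6.** There is an absolute constant $c\in\mathbb N$ such that for every $A>0$ there is a constant $C>0$,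 depending only on $A$, such that the following holds. Let $m\ge 2$, and suppose that the $n$ Bernoulli jobs have at most $A\,(1+\log_2 n)$ distinct size parameters $s_j$, each at most $n^8$. (For $n = 0$ read $\log_2 n$ as $0$.) Then StochFree outputs a list schedule and, whichever way ties and arbitrary choices are resolved, its expected total completion time satisfies $$\mathbb E[\mathsf{alg}]\;\le\; C\, m\,(1+\log_2 n)^{c}\;\mathbb E[\mathsf{opt}],$$ where $\mathbb E[\mathsf{opt}]$ is the optimal expected total completion time, i.e. the inequality holds with the expected total completion time of any adaptive policy on the right-hand side. In short, StochFree is an $\widetilde O(m)$-approximation to the optimal adaptive policy. -/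

import Mathlib

open scoped BigOperators

namespace StochSched

noncomputable section

/-- A collection of `n` Bernoulli jobs: job `j` has processing time `s_j` with probability `p_j`
and `0` with probability `1 - p_j`, independently across jobs. -/
structure BernoulliJobs (n : ℕ) where
  size : Fin n → ℝ
  prob : Fin n → ℝ
  size_nonneg : ∀ j, 0 ≤ size j
  prob_nonneg : ∀ j, 0 ≤ prob j
  prob_le_one : ∀ j, prob j ≤ 1

namespace BernoulliJobs

variable {n : ℕ} (J : BernoulliJobs n)

/-- The processing time of job `j` in the realization `ω` (`ω j = true` means heads). -/
def procTime (ω : Fin n → Bool) (j : Fin n) : ℝ := if ω j = true then J.size j else 0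

/-- The probability of the realization `ω`: the coins are independent. -/
def weight (ω : Fin n → Bool) : ℝ := ∏ j, if ω j = true then J.prob j else 1 - J.prob j

/-- Expectation over the realizations of all the jobs. -/
def expect (f : (Fin n → Bool) → ℝ) : ℝ := ∑ ω, J.weight ω * f ω

/-- There are at most `A (1 + log₂ n)` distinct size parameters, each at most `n ^ 8`. -/
def Rescaled (A : ℝ) : Prop :=
  ((Finset.univ.image J.size).card : ℝ) ≤ A * (1 + Real.logb 2 n) ∧
    ∀ j, J.size j ≤ (n : ℝ) ^ 8

/-- A (deterministic, non-preemptive) adaptive scheduling policy on `m` identical machines.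
In the realization `ω`, its `t`-th decision is to start job `job ω t` on machine `machine ω t`
at time `start ω t`. Decisions are made in chronological order; machines may be left idle.
A Bernoulli job reveals its processing time as soon as it is started, so that a decision may depend
on the outcomes of the jobs started by earlier decisions, and on nothing else. -/
structure AdaptivePolicy (m : ℕ) where
  /-- the order in which the jobs are started; every job is started exactly once -/
  job : (Fin n → Bool) → Equiv.Perm (Fin n)
  machine : (Fin n → Bool) → Fin n → Fin m
  start : (Fin n → Bool) → Fin n → ℝ
  start_nonneg : ∀ ω t, 0 ≤ start ω t
  /-- decisions are made in chronological order -/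
  start_mono : ∀ ω, Monotone (start ω)
  /-- a machine processes one job at a time, without preemption -/
  no_overlap : ∀ ω t u, u < t → machine ω u = machine ω t →
    start ω u + J.procTime ω (job ω u) ≤ start ω t
  /-- two realizations that agree on the jobs started so far lead to the same next decision -/
  nonanticipating : ∀ ω ω' t, (∀ u < t, ω (job ω u) = ω' (job ω u)) →
    job ω t = job ω' t ∧ machine ω t = machine ω' t ∧ start ω t = start ω' t

/-- The expected total completion time `𝔼 ∑_j C_j` of an adaptive policy. -/
def AdaptivePolicy.cost {J : BernoulliJobs n} {m : ℕ} (P : J.AdaptivePolicy m) : ℝ :=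
  J.expect fun ω => ∑ t, (P.start ω t + J.procTime ω (P.job ω t))

/-! ### List schedules -/

/-- A least-loaded machine. -/
def leastLoaded {m : ℕ} [NeZero m] (l : Fin m → ℝ) : Fin m :=
  (Finite.exists_min l).choose

lemma leastLoaded_le {m : ℕ} [NeZero m] (l : Fin m → ℝ) (i : Fin m) :
    l (leastLoaded l) ≤ l i :=
  (Finite.exists_min l).choose_spec i

/-- The machine loads after the first `t` jobs `σ 0, …, σ (t - 1)` of the list have been started,
each one on a least-loaded machine, in the realization `ω`. -/
def listLoads (m : ℕ) [NeZero m] (σ : Equiv.Perm (Fin n)) (ω : Fin n → Bool) : ℕ → Fin m → ℝ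
  | 0 => fun _ => 0
  | t + 1 =>
    let l := listLoads m σ ω t
    if h : t < n then
      Function.update l (leastLoaded l) (l (leastLoaded l) + J.procTime ω (σ ⟨t, h⟩))
    else l

lemma procTime_nonneg (ω : Fin n → Bool) (j : Fin n) : 0 ≤ J.procTime ω j := by
  unfold procTime
  split_ifs
  · exact J.size_nonneg j
  · exact le_rfl

lemma listLoads_le_succ (m : ℕ) [NeZero m] (σ : Equiv.Perm (Fin n)) (ω : Fin n → Bool) (t : ℕ)
    (i : Fin m) : J.listLoads m σ ω t i ≤ J.listLoads m σ ω (t + 1) i := by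
  simp only [listLoads]
  split_ifs with h
  · by_cases hi : i = leastLoaded (J.listLoads m σ ω t)
    · subst hi
      simpa using J.procTime_nonneg ω _
    · rw [Function.update_of_ne hi]
  · exact le_rfl

lemma listLoads_mono (m : ℕ) [NeZero m] (σ : Equiv.Perm (Fin n)) (ω : Fin n → Bool)
    (i : Fin m) : Monotone fun t => J.listLoads m σ ω t i :=
  monotone_nat_of_le_succ fun t => J.listLoads_le_succ m σ ω t i

lemma listLoads_congr (m : ℕ) [NeZero m] (σ : Equiv.Perm (Fin n)) (ω ω' : Fin n → Bool) (t : ℕ)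
    (h : ∀ u : Fin n, (u : ℕ) < t → ω (σ u) = ω' (σ u)) :
    J.listLoads m σ ω t = J.listLoads m σ ω' t := by
  induction t with
  | zero => rfl
  | succ t ih =>
    have e := ih fun u hu => h u (hu.trans (Nat.lt_succ_self t))
    simp only [listLoads, e]
    split_ifs with ht
    · have := h ⟨t, ht⟩ (Nat.lt_succ_self t)
      simp only [procTime, this]
    · rfl

/-- The list schedule of the ordering `σ` (the `t`-th job of the list is `σ t`): whenever a machine
is free, it starts the next job of the list. In other words, each job of the list in turn is
started on a least-loaded machine, as soon as that machine is free. -/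
def listSchedule (m : ℕ) [NeZero m] (σ : Equiv.Perm (Fin n)) : J.AdaptivePolicy m where
  job _ := σ
  machine ω t := leastLoaded (J.listLoads m σ ω t)
  start ω t := J.listLoads m σ ω t (leastLoaded (J.listLoads m σ ω t))
  start_nonneg ω t := J.listLoads_mono m σ ω _ (Nat.zero_le t)
  start_mono ω _ t hut :=
    (leastLoaded_le _ (leastLoaded (J.listLoads m σ ω t))).trans (J.listLoads_mono m σ ω _ hut)
  no_overlap ω t u hut hm := by
    have h1 := J.listLoads_mono m σ ω (leastLoaded (J.listLoads m σ ω t))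
      (Nat.succ_le_of_lt hut : (u : ℕ) + 1 ≤ t)
    simp only [← hm] at h1 ⊢
    refine le_trans (le_of_eq ?_) h1
    simp [listLoads]
  nonanticipating ω ω' t h := by
    have e := J.listLoads_congr m σ ω ω' t fun u hu => h u hu
    simp only [e, and_self]

/-! ### The algorithm StochFree -/

/-- `r` ranks the jobs in increasing order of their probabilities (ties are broken arbitrarily). -/
def IsProbRank (r : Equiv.Perm (Fin n)) : Prop := ∀ i j, J.prob i < J.prob j → r i < r j

/-- The `q` jobs of size parameter `s` with the largest probabilities, with respect to the ranking
`r` (all the jobs of size parameter `s` if there are at most `q` of them). -/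
def topJobs (r : Equiv.Perm (Fin n)) (s : ℝ) (q : ℕ) : Finset (Fin n) :=
  {j | J.size j = s ∧ (Finset.univ.filter fun i => J.size i = s ∧ r j < r i).card < q}

/-- ChooseJobs: the set `J_k`, obtained from the set of all jobs by removing, for each size
parameter `s`, the `⌊n / 2 ^ k⌋` jobs of size parameter `s` with largest probabilities.
For `k = 0` this is the empty set. -/
def chooseJobs (r : Equiv.Perm (Fin n)) (k : ℕ) : Finset (Fin n) :=
  Finset.univ \ (Finset.univ.image J.size).biUnion fun s => J.topJobs r s (n / 2 ^ k)

/-- `σ` is a list that StochFree may output, when ChooseJobs breaks ties according to the ranking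
`r`: for `k = 1, …, ⌊log₂ n⌋` in turn the batch `J_k \ J_{k-1}`, in increasing order of the size
parameters, and then all the remaining jobs, in arbitrary order. -/
def IsStochFreeList (r σ : Equiv.Perm (Fin n)) : Prop :=
  J.IsProbRank r ∧
  ∀ k ∈ Finset.Icc 1 (Nat.log 2 n),
    (∀ i ∈ J.chooseJobs r k, ∀ j ∉ J.chooseJobs r k, σ.symm i < σ.symm j) ∧
    (∀ i ∈ J.chooseJobs r k \ J.chooseJobs r (k - 1),
      ∀ j ∈ J.chooseJobs r k \ J.chooseJobs r (k - 1),
        J.size i < J.size j → σ.symm i < σ.symm j)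

end BernoulliJobs

end

end StochSched

namespace StochSched

open Finset

/-! ### The elements of largest rank of a finite set -/

/-! Write q = ⌊n/2^k⌋ and let `excess` be the total processing time of a set of jobs without its m -
1 longest ones. Two facts make it the right potential. In a list schedule, a job of J_k starts no
later than the excess of J_k (`start_le_of_mem`). In any policy, m times the start time of a
decision is at least the excess of the jobs started before it (`excess_started_le`).

The two are compared by stochastic domination. A policy leaves q jobs to start after its first n - q
decisions; even choosing adaptively, it does no better than to leave the q likeliest
(`expect_heads_le`, by an exchange argument). This holds for the head count above each size
threshold separately, and `excess` is a nonnegative combination of increasing functions of these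
counts. Removing the top q of every size class removes the top q above every threshold, so a single
J_k serves all thresholds (`inter_chooseJobs_subset`).

Hence q times the expected excess of J_k is at most m times the policy's expected sum of start
times. With L distinct sizes, at most 3Lq jobs lie outside J_{k-1}, so each of the ⌊log₂ n⌋ batches
costs O(Lm) times the policy's cost. At most L jobs remain at the end, and a crude bound suffices
for them. -/

/-- The `q` elements of `R` with the largest rank. -/
def topRanked {n : ℕ} (r : Equiv.Perm (Fin n)) (q : ℕ) (R : Finset (Fin n)) : Finset (Fin n) :=
  R.filter fun j => (R.filter fun i => r j < r i).card < q

section TopRanked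

variable {n : ℕ} (r : Equiv.Perm (Fin n)) (q : ℕ) (R : Finset (Fin n))

lemma card_filter_rank_lt {x y : Fin n} (hy : y ∈ R) (hxy : r x < r y) :
    (R.filter fun i => r y < r i).card < (R.filter fun i => r x < r i).card := by
  apply Finset.card_lt_card
  rw [Finset.ssubset_iff_of_subset]
  · exact ⟨y, by simp [hy, hxy], by simp⟩
  · intro i hi
    simp only [mem_filter] at hi ⊢
    exact ⟨hi.1, hxy.trans hi.2⟩

lemma card_topRanked_le : (topRanked r q R).card ≤ q := by
  have h := Finset.card_le_card_of_injOn (s := topRanked r q R) (t := Finset.range q)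
    (fun j => (R.filter fun i => r j < r i).card) ?_ ?_
  · simpa using h
  · intro j hj
    simpa using (mem_filter.1 hj).2
  · intro x hx y hy hxy
    have hx' := (mem_filter.1 hx).1
    have hy' := (mem_filter.1 hy).1
    rcases lt_trichotomy (r x) (r y) with h | h | h
    · exact absurd hxy (card_filter_rank_lt r R hy' h).ne'
    · exact r.injective h
    · exact absurd hxy (card_filter_rank_lt r R hx' h).ne

lemma topRanked_eq_self (h : R.card ≤ q) : topRanked r q R = R := by
  refine Finset.filter_true_of_mem fun j hj => lt_of_lt_of_le ?_ h
  refine Finset.card_lt_card ((Finset.ssubset_iff_of_subset (filter_subset _ _)).2 ⟨j, hj, by simp⟩)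

/-- When `j` leaves `R`, at most one element `w`, of smaller rank than `j`, enters the top. -/
lemma exists_topRanked_erase (j : Fin n) :
    ∃ w, (w = j ∨ (w ∈ R ∧ w ∉ topRanked r q R ∧ (j ∈ topRanked r q R) ∧ r w < r j)) ∧
      topRanked r q (R.erase j) ⊆ (topRanked r q R).image (Equiv.swap w j) := by
  by_cases hsub : topRanked r q (R.erase j) ⊆ topRanked r q R
  · exact ⟨j, Or.inl rfl, by simpa using hsub⟩
  · obtain ⟨w, hw, hw'⟩ := Finset.not_subset.1 hsub
    simp only [topRanked, mem_filter, mem_erase, not_and, not_lt] at hw hw'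
    obtain ⟨⟨hwj, hwR⟩, hcard⟩ := hw
    have hq := hw' hwR
    rw [Finset.filter_erase] at hcard
    have hjmem : j ∈ R.filter fun i => r w < r i := by
      by_contra hj
      rw [Finset.erase_eq_of_notMem hj] at hcard
      omega
    rw [Finset.card_erase_of_mem hjmem] at hcard
    simp only [mem_filter] at hjmem
    have hj : j ∈ topRanked r q R := by
      have := card_filter_rank_lt r R hjmem.1 hjmem.2
      simp only [topRanked, mem_filter]
      exact ⟨hjmem.1, by omega⟩
    refine ⟨w, Or.inr ⟨hwR, ?_, hj, hjmem.2⟩, ?_⟩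
    -- Exactly q elements of R outrank `w`, so `w` is the next in line below the top; hence it is
    -- the only newcomer.
    · simp only [topRanked, mem_filter, not_and, not_lt]
      exact fun _ => hq
    · intro x hx
      by_cases hxw : x = w
      · subst hxw
        exact mem_image.2 ⟨j, hj, by simp⟩
      · simp only [topRanked, mem_filter, mem_erase] at hx
        refine mem_image.2 ⟨x, ?_, Equiv.swap_apply_of_ne_of_ne hxw hx.1.1⟩
        refine mem_filter.2 ⟨hx.1.2, ?_⟩
        have h2 := hx.2
        rw [Finset.filter_erase] at h2
        have h3 := Finset.pred_card_le_card_erase (s := R.filter fun i => r x < r i) (a := j)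
        rcases lt_trichotomy (r x) (r w) with h | h | h
        · have := card_filter_rank_lt r R hwR h
          omega
        · exact absurd (r.injective h) hxw
        · have := card_filter_rank_lt r R hx.1.2 h
          omega

end TopRanked

/-! ### Tail counts and gaps of finite sets of reals -/

/-- The elements of largest value can be removed so that all the tail counts drop by `k`. -/
lemma exists_remove_largest {ι : Type*} [DecidableEq ι] (s : ι → ℝ) (k : ℕ) (H : Finset ι) :
    ∃ Z : Finset ι, Z.card ≤ k ∧ ∀ θ : ℝ,
      ((H \ Z).filter fun j => θ ≤ s j).card ≤ (H.filter fun j => θ ≤ s j).card - k := by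
  induction k generalizing H with
  | zero => exact ⟨∅, by simp, by simp⟩
  | succ k ih =>
    rcases H.eq_empty_or_nonempty with rfl | hne
    · exact ⟨∅, by simp, by simp⟩
    · obtain ⟨j, hj, hmax⟩ := H.exists_max_image s hne
      obtain ⟨Z, hZ, hcount⟩ := ih (H.erase j)
      refine ⟨insert j Z, (card_insert_le _ _).trans (by omega), fun θ => ?_⟩
      have h := hcount θ
      rw [show H \ insert j Z = H.erase j \ Z by ext; simp; tauto]
      by_cases hθ : θ ≤ s j
      · rw [Finset.filter_erase, card_erase_of_mem (mem_filter.2 ⟨hj, hθ⟩)] at h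
        omega
      · have : H.filter (fun i => θ ≤ s i) = ∅ :=
          filter_eq_empty_iff.2 fun i hi h' => hθ (h'.trans (hmax i hi))
        rw [Finset.filter_erase, this] at h
        exact h.trans (by simp)

/-- Nonnegative gaps whose partial sums are the elements of a finite set of nonnegative reals. -/
lemma exists_gaps (Θ : Finset ℝ) (h0 : ∀ θ ∈ Θ, 0 ≤ θ) :
    ∃ δ : ℝ → ℝ, (∀ θ, 0 ≤ δ θ) ∧ ∀ s ∈ Θ, ∑ θ ∈ Θ with θ ≤ s, δ θ = s := by
  -- The bound on the total makes the next gap, new maximum minus total, nonnegative; quantifying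
  -- over `b` covers the empty set.
  suffices H : ∃ δ : ℝ → ℝ, (∀ θ, 0 ≤ δ θ) ∧ (∀ s ∈ Θ, ∑ θ ∈ Θ with θ ≤ s, δ θ = s) ∧
      ∀ b, 0 ≤ b → (∀ θ ∈ Θ, θ ≤ b) → ∑ θ ∈ Θ, δ θ ≤ b from
    H.imp fun δ h => ⟨h.1, h.2.1⟩
  induction Θ using Finset.induction_on_max with
  | empty => exact ⟨0, by simp, by simp, by simp⟩
  | insert a Θ hlt ih =>
    obtain ⟨δ, hδ, hsum, hle⟩ := ih fun θ hθ => h0 θ (mem_insert_of_mem hθ)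
    have ha : a ∉ Θ := fun h => lt_irrefl _ (hlt a h)
    have hnn : ∑ θ ∈ Θ, δ θ ≤ a := hle a (h0 a (mem_insert_self _ _)) fun θ hθ => (hlt θ hθ).le
    have hcongr : ∀ T ⊆ Θ, ∑ θ ∈ T, Function.update δ a (a - ∑ θ ∈ Θ, δ θ) θ = ∑ θ ∈ T, δ θ :=
      fun T hT => sum_congr rfl fun θ hθ =>
        Function.update_of_ne (ne_of_mem_of_not_mem (hT hθ) ha) _ _
    have htot : ∑ θ ∈ insert a Θ, Function.update δ a (a - ∑ θ ∈ Θ, δ θ) θ = a := by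
      rw [sum_insert ha, hcongr Θ Subset.rfl]
      simp
    refine ⟨Function.update δ a (a - ∑ θ ∈ Θ, δ θ), fun θ => ?_, fun s hs => ?_, fun b _ hb => ?_⟩
    · by_cases h : θ = a
      · subst h; simpa using hnn
      · rw [Function.update_of_ne h]; exact hδ θ
    · rcases mem_insert.1 hs with rfl | hs
      · rw [filter_true_of_mem, htot]
        intro θ hθ
        rcases mem_insert.1 hθ with rfl | hθ
        exacts [le_rfl, (hlt θ hθ).le]
      · rw [filter_insert, if_neg (not_le.2 (hlt s hs)), hcongr _ (filter_subset _ _), hsum s hs]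
    · rw [htot]
      exact hb a (mem_insert_self _ _)

end StochSched

namespace StochSched

open Finset

namespace BernoulliJobs

variable {n : ℕ} (J : BernoulliJobs n)

/-! ### Expectations -/

lemma weight_nonneg (ω : Fin n → Bool) : 0 ≤ J.weight ω :=
  Finset.prod_nonneg fun j _ => by
    split_ifs
    · exact J.prob_nonneg j
    · exact sub_nonneg.2 (J.prob_le_one j)

lemma expect_mono {f g : (Fin n → Bool) → ℝ} (h : ∀ ω, f ω ≤ g ω) : J.expect f ≤ J.expect g :=
  Finset.sum_le_sum fun ω _ => mul_le_mul_of_nonneg_left (h ω) (J.weight_nonneg ω)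

lemma expect_add (f g : (Fin n → Bool) → ℝ) :
    J.expect (fun ω => f ω + g ω) = J.expect f + J.expect g := by
  simp [expect, mul_add, sum_add_distrib]

lemma expect_const_mul (c : ℝ) (f : (Fin n → Bool) → ℝ) :
    J.expect (fun ω => c * f ω) = c * J.expect f := by
  simp only [expect, mul_sum]
  exact sum_congr rfl fun ω _ => by ring

lemma expect_sum {ι : Type*} (s : Finset ι) (f : ι → (Fin n → Bool) → ℝ) :
    J.expect (fun ω => ∑ i ∈ s, f i ω) = ∑ i ∈ s, J.expect (f i) := by
  simp only [expect, mul_sum]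
  exact sum_comm

lemma expect_nonneg {f : (Fin n → Bool) → ℝ} (h : ∀ ω, 0 ≤ f ω) : 0 ≤ J.expect f :=
  Finset.sum_nonneg fun ω _ => mul_nonneg (J.weight_nonneg ω) (h ω)

/-! ### Stochastic domination for adaptively chosen sets of coins -/

/-- The number of heads in a set of jobs. -/
def heads (B : Finset (Fin n)) (ω : Fin n → Bool) : ℕ := (B.filter fun j => ω j = true).card

lemma heads_mono {B C : Finset (Fin n)} (h : B ⊆ C) (ω : Fin n → Bool) : heads B ω ≤ heads C ω :=
  card_le_card (filter_subset_filter _ h)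

lemma heads_image (B : Finset (Fin n)) (e : Equiv.Perm (Fin n)) (ω : Fin n → Bool) :
    heads (B.image e) ω = heads B (ω ∘ e) := by
  rw [heads, filter_image, card_image_of_injective _ e.injective]
  rfl

/-- Moving heads from a coin to one of larger probability makes a realization more likely. -/
lemma weight_le_weight_swap {w j : Fin n} (hp : J.prob w ≤ J.prob j) {ω : Fin n → Bool}
    (hw : ω w = true) (hj : ω j = false) : J.weight ω ≤ J.weight (ω ∘ Equiv.swap w j) := by
  have hwj : w ≠ j := fun h => by simp [h, hj] at hw
  have hmem : j ∈ univ.erase w := by simp [hwj.symm]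
  unfold weight
  rw [← mul_prod_erase univ _ (mem_univ w), ← mul_prod_erase univ _ (mem_univ w),
    ← mul_prod_erase (univ.erase w) _ hmem, ← mul_prod_erase (univ.erase w) _ hmem,
    ← mul_assoc, ← mul_assoc]
  have hrest : ∏ x ∈ (univ.erase w).erase j,
      (if (ω ∘ Equiv.swap w j) x = true then J.prob x else 1 - J.prob x) =
      ∏ x ∈ (univ.erase w).erase j, (if ω x = true then J.prob x else 1 - J.prob x) := by
    refine prod_congr rfl fun x hx => ?_
    simp only [mem_erase] at hx
    simp [Equiv.swap_apply_of_ne_of_ne hx.2.1 hx.1]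
  rw [hrest]
  refine mul_le_mul_of_nonneg_right ?_ (Finset.prod_nonneg fun i _ => ?_)
  · simp [hw, hj]
    nlinarith
  · split_ifs
    · exact J.prob_nonneg i
    · exact sub_nonneg.2 (J.prob_le_one i)

/-- Exchanging a coin `w ω` of the set `A ω` for a coin `j ω` of larger probability outside of
it, where `A`, `w` and `j` do not depend on these two coins, makes the number of heads larger. -/
lemma expect_heads_le_expect_heads_swap {f : ℕ → ℝ} (hf : Monotone f)
    (A : (Fin n → Bool) → Finset (Fin n)) (w j : (Fin n → Bool) → Fin n)
    (hA : ∀ ω, A (ω ∘ Equiv.swap (w ω) (j ω)) = A ω)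
    (hw : ∀ ω, w (ω ∘ Equiv.swap (w ω) (j ω)) = w ω)
    (hj : ∀ ω, j (ω ∘ Equiv.swap (w ω) (j ω)) = j ω)
    (hwj : ∀ ω, w ω = j ω ∨ (w ω ∈ A ω ∧ j ω ∉ A ω ∧ J.prob (w ω) ≤ J.prob (j ω))) :
    J.expect (fun ω => f (heads (A ω) ω)) ≤
      J.expect (fun ω => f (heads ((A ω).image (Equiv.swap (w ω) (j ω))) ω)) := by
  -- The swapped pair depends on `ω`, but is itself unchanged by the swap, so `τ` is an involution
  -- and sums over `ω` can be reindexed by it.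
  set τ : (Fin n → Bool) → (Fin n → Bool) := fun ω => ω ∘ Equiv.swap (w ω) (j ω) with hτ
  have hinv : Function.Involutive τ := by
    intro ω
    have h1 : w (τ ω) = w ω := hw ω
    have h2 : j (τ ω) = j ω := hj ω
    funext x
    simp only [hτ, Function.comp_apply] at h1 h2 ⊢
    rw [h1, h2]
    simp
  set g : (Fin n → Bool) → ℝ := fun ω => f (heads (A ω) ω) with hg
  have hgτ : ∀ ω, f (heads ((A ω).image (Equiv.swap (w ω) (j ω))) ω) = g (τ ω) := by
    intro ω
    simp only [hg]
    rw [heads_image, show A (τ ω) = A ω from hA ω]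
  simp only [hgτ]
  have hre : ∀ F : (Fin n → Bool) → ℝ, ∑ ω, F (τ ω) = ∑ ω, F ω := fun F =>
    Equiv.sum_comp (hinv.toPerm) F
  have e1 : J.expect (fun ω => g (τ ω)) = ∑ ω, J.weight (τ ω) * g ω := by
    rw [expect, ← hre]
    simp only [hinv _]
  have e2 : J.expect g = ∑ ω, J.weight (τ ω) * g (τ ω) := (hre fun ω => J.weight ω * g ω).symm
  -- A rearrangement inequality: in each orbit of `τ`, the realization with heads on `w` has the
  -- larger `g` and the smaller weight. Expanding the sum gives twice the desired difference.
  have key : 0 ≤ ∑ ω, (J.weight (τ ω) - J.weight ω) * (g ω - g (τ ω)) := by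
    refine Finset.sum_nonneg fun ω _ => ?_
    have hcomm : τ ω = ω ∘ Equiv.swap (w ω) (j ω) := rfl
    rcases hwj ω with h | ⟨h1, h2, h3⟩
    · have : τ ω = ω := by rw [hcomm, h]; simp
      simp [this]
    · have hne : w ω ≠ j ω := fun h => h2 (h ▸ h1)
      have himg : ∀ ω', heads (A ω) ω' = heads ((A ω).erase (w ω)) ω' +
          if ω' (w ω) = true then 1 else 0 := by
        intro ω'
        conv_lhs => rw [← insert_erase h1]
        rw [heads, filter_insert]
        split_ifs with h
        · rw [card_insert_of_notMem (by simp)]; rfl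
        · rfl
      have hrest : heads ((A ω).erase (w ω)) (τ ω) = heads ((A ω).erase (w ω)) ω := by
        unfold heads
        congr 1
        refine filter_congr fun x hx => ?_
        have hx' := mem_erase.1 hx
        rw [hcomm, Function.comp_apply, Equiv.swap_apply_of_ne_of_ne hx'.1
          (ne_of_mem_of_not_mem hx'.2 h2)]
      have hgω : g ω = f (heads ((A ω).erase (w ω)) ω + if ω (w ω) = true then 1 else 0) := by
        simp only [hg]; rw [himg]
      have hgτω : g (τ ω) = f (heads ((A ω).erase (w ω)) ω + if ω (j ω) = true then 1 else 0) := by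
        simp only [hg]
        rw [show A (τ ω) = A ω from hA ω, himg, hrest, hcomm]
        simp
      cases hbw : ω (w ω) <;> cases hbj : ω (j ω)
      · simp [hgω, hgτω, hbw, hbj]
      · have hle := J.weight_le_weight_swap h3 (ω := τ ω) (by simp [hcomm, hbj])
          (by simp [hcomm, hbw])
        have hback : τ ω ∘ Equiv.swap (w ω) (j ω) = ω := by
          funext x; simp [hcomm]
        rw [hback] at hle
        refine mul_nonneg_of_nonpos_of_nonpos (sub_nonpos.2 hle) (sub_nonpos.2 ?_)
        rw [hgω, hgτω]
        exact hf (by simp [hbw])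
      · have hle := J.weight_le_weight_swap h3 hbw hbj
        refine mul_nonneg (sub_nonneg.2 hle) (sub_nonneg.2 ?_)
        rw [hgω, hgτω]
        exact hf (by simp [hbj])
      · simp [hgω, hgτω, hbw, hbj]
  have e3 : ∑ ω, J.weight ω * g (τ ω) = J.expect fun ω => g (τ ω) := rfl
  have e4 : ∑ ω, J.weight ω * g ω = J.expect g := rfl
  have expand : ∑ ω, (J.weight (τ ω) - J.weight ω) * (g ω - g (τ ω)) =
      2 * (J.expect (fun ω => g (τ ω)) - J.expect g) := by
    simp only [sub_mul, mul_sub, sum_sub_distrib]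
    rw [← e1, ← e2, e3, e4]
    ring
  linarith

variable {J} {m : ℕ}

/-- The jobs started by the first `t` decisions of a policy. -/
def AdaptivePolicy.started (P : J.AdaptivePolicy m) (t : ℕ) (ω : Fin n → Bool) :
    Finset (Fin n) :=
  (univ.filter fun u : Fin n => (u : ℕ) < t).image (P.job ω)

lemma AdaptivePolicy.mem_started (P : J.AdaptivePolicy m) (t : ℕ) (ω : Fin n → Bool)
    (u : Fin n) : P.job ω u ∈ P.started t ω ↔ (u : ℕ) < t := by
  simp [started]

lemma AdaptivePolicy.started_succ (P : J.AdaptivePolicy m) (t : Fin n) (ω : Fin n → Bool) :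
    P.started (t + 1) ω = insert (P.job ω t) (P.started t ω) := by
  ext x
  obtain ⟨u, rfl⟩ := (P.job ω).surjective x
  rw [mem_insert, mem_started, mem_started, (P.job ω).injective.eq_iff, Fin.ext_iff]
  omega

lemma AdaptivePolicy.card_started (P : J.AdaptivePolicy m) {t : ℕ} (ht : t ≤ n)
    (ω : Fin n → Bool) : (P.started t ω).card = t := by
  rw [started, card_image_of_injective _ (P.job ω).injective]
  rw [Fin.card_filter_val_lt, min_eq_right ht]

lemma AdaptivePolicy.job_eq (P : J.AdaptivePolicy m) {t : Fin n} {ω ω' : Fin n → Bool}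
    (h : ∀ i ∈ P.started t ω, ω' i = ω i) {u : Fin n} (hu : u ≤ t) : P.job ω' u = P.job ω u :=
  (P.nonanticipating ω ω' u fun v hv =>
    (h _ ((P.mem_started t ω v).2 (hv.trans_le hu))).symm).1.symm

lemma AdaptivePolicy.started_eq (P : J.AdaptivePolicy m) {t : Fin n} {ω ω' : Fin n → Bool}
    (h : ∀ i ∈ P.started t ω, ω' i = ω i) : P.started t ω' = P.started t ω :=
  image_congr fun u hu => P.job_eq h (le_of_lt (by simpa using hu))

/-- Among the jobs of `U`, a policy that has started all but at most `q` jobs has at least as many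
heads as the jobs of `U` without the `q` most likely ones. -/
lemma AdaptivePolicy.expect_heads_le (P : J.AdaptivePolicy m) {f : ℕ → ℝ} (hf : Monotone f)
    {r : Equiv.Perm (Fin n)} (hr : J.IsProbRank r) (q : ℕ) (U : Finset (Fin n)) :
    J.expect (fun ω => f (heads (U \ topRanked r q U) ω)) ≤
      J.expect fun ω => f (heads (U ∩ P.started (n - q) ω) ω) := by
  -- Hybrid sets: the jobs of `U` already started, plus the unstarted ones without their q
  -- likeliest. At t = 0 no job is started; at t = n - q at most q jobs are unstarted, so only the
  -- started ones count.
  have hstep : ∀ t : ℕ, t ≤ n → J.expect (fun ω => f (heads (U \ topRanked r q U) ω)) ≤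
      J.expect fun ω => f (heads (U \ topRanked r q (U \ P.started t ω)) ω) := by
    intro t
    induction t with
    | zero => intro _; simp [started]
    | succ t ih =>
      intro ht
      refine (ih (by omega)).trans ?_
      obtain ⟨t, rfl⟩ : ∃ t' : Fin n, t = t' := ⟨⟨t, ht⟩, rfl⟩
      choose w hw hsub using fun (R : Finset (Fin n)) (j : Fin n) =>
        exists_topRanked_erase r q R j
      set R : (Fin n → Bool) → Finset (Fin n) := fun ω => U \ P.started t ω with hR
      -- Both swapped coins are still unrevealed, so the policy's choice of the next job does not
      -- see the swap.
      have hagree : ∀ ω, ∀ i ∈ P.started t ω,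
          (ω ∘ Equiv.swap (w (R ω) (P.job ω t)) (P.job ω t)) i = ω i := by
        intro ω i hi
        have hij : i ≠ P.job ω t := by
          rintro rfl
          exact lt_irrefl _ ((P.mem_started t ω t).1 hi)
        have hiw : i ≠ w (R ω) (P.job ω t) := by
          rcases hw (R ω) (P.job ω t) with h | h
          · rwa [h]
          · rintro rfl
            exact (mem_sdiff.1 h.1).2 hi
        rw [Function.comp_apply, Equiv.swap_apply_of_ne_of_ne hiw hij]
      have hjob := fun ω => P.job_eq (hagree ω) le_rfl
      have hRinv : ∀ ω, R (ω ∘ Equiv.swap (w (R ω) (P.job ω t)) (P.job ω t)) = R ω := by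
        intro ω
        simp only [hR]
        rw [P.started_eq (hagree ω)]
      have hsw := J.expect_heads_le_expect_heads_swap hf
        (fun ω => U \ topRanked r q (R ω)) (fun ω => w (R ω) (P.job ω t)) (fun ω => P.job ω t)
        (fun ω => by simp only [hRinv]) (fun ω => by simp only [hRinv, hjob]) hjob ?_
      · refine hsw.trans (J.expect_mono fun ω => hf (heads_mono ?_ ω))
        have hRs : U \ P.started (t + 1) ω = (R ω).erase (P.job ω t) := by
          rw [P.started_succ]
          ext; simp [hR]; tauto
        rw [hRs]
        intro x hx
        obtain ⟨y, hy, rfl⟩ := mem_image.1 hx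
        have hy' := mem_sdiff.1 hy
        rw [mem_sdiff]
        constructor
        · rcases hw (R ω) (P.job ω t) with h | h
          · rw [h]; simpa using hy'.1
          · have hwU := (mem_sdiff.1 h.1).1
            have hjU := (mem_sdiff.1 (mem_filter.1 h.2.2.1).1).1
            rw [Equiv.swap_apply_def]
            split_ifs
            exacts [hjU, hwU, hy'.1]
        · intro hmem
          obtain ⟨z, hz, hzy⟩ := mem_image.1 (hsub _ _ hmem)
          exact hy'.2 ((Equiv.swap _ _).injective hzy ▸ hz)
      · intro ω
        rcases hw (R ω) (P.job ω t) with h | h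
        · exact Or.inl h
        · refine Or.inr ⟨mem_sdiff.2 ⟨(mem_sdiff.1 h.1).1, h.2.1⟩,
            fun hmem => (mem_sdiff.1 hmem).2 h.2.2.1, ?_⟩
          by_contra hlt
          exact absurd (hr _ _ (not_le.1 hlt)) (not_lt.2 h.2.2.2.le)
  refine (hstep (n - q) (Nat.sub_le n q)).trans (J.expect_mono fun ω => hf (heads_mono ?_ ω))
  rw [topRanked_eq_self]
  · intro x hx
    simp at hx ⊢
    tauto
  · refine (card_le_card (sdiff_subset_sdiff (subset_univ U) Subset.rfl)).trans ?_
    rw [card_univ_sdiff, P.card_started (Nat.sub_le n q), Fintype.card_fin]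
    omega

end BernoulliJobs

end StochSched

/-! ### Processing times decomposed by size thresholds -/

namespace StochSched

open Finset

namespace BernoulliJobs

variable {n : ℕ} (J : BernoulliJobs n)

/-- The jobs of size at least `θ`. -/
noncomputable def sizeGE (θ : ℝ) : Finset (Fin n) := univ.filter fun j => θ ≤ J.size j

/-- If `δ` are the gaps between consecutive sizes, the total processing time of the jobs in `B`
without the `k` longest ones. -/
noncomputable def excess (δ : ℝ → ℝ) (k : ℕ) (B : Finset (Fin n)) (ω : Fin n → Bool) : ℝ :=
  ∑ θ ∈ univ.image J.size, δ θ * ((heads (J.sizeGE θ ∩ B) ω - k : ℕ) : ℝ)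

/-- `δ` are the gaps between consecutive sizes. -/
def IsGaps (δ : ℝ → ℝ) : Prop :=
  (∀ θ, 0 ≤ δ θ) ∧ ∀ j, ∑ θ ∈ univ.image J.size with θ ≤ J.size j, δ θ = J.size j

lemma exists_isGaps : ∃ δ, J.IsGaps δ := by
  obtain ⟨δ, h0, h⟩ := exists_gaps (univ.image J.size) (by simpa using J.size_nonneg)
  exact ⟨δ, h0, fun j => h _ (mem_image_of_mem _ (mem_univ j))⟩

variable {J} {δ : ℝ → ℝ}

lemma excess_nonneg (hδ : J.IsGaps δ) (k : ℕ) (B : Finset (Fin n)) (ω : Fin n → Bool) :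
    0 ≤ J.excess δ k B ω :=
  sum_nonneg fun θ _ => mul_nonneg (hδ.1 θ) (Nat.cast_nonneg _)

lemma sum_procTime_eq (hδ : J.IsGaps δ) (B : Finset (Fin n)) (ω : Fin n → Bool) :
    ∑ j ∈ B, J.procTime ω j =
      ∑ θ ∈ univ.image J.size, δ θ * (heads (J.sizeGE θ ∩ B) ω : ℝ) := by
  have h1 : ∀ j, J.procTime ω j =
      ∑ θ ∈ univ.image J.size, if θ ≤ J.size j ∧ ω j = true then δ θ else 0 := by
    intro j
    unfold procTime
    split_ifs with h
    · simp only [h, and_true]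
      rw [← sum_filter, hδ.2 j]
    · simp [h]
  simp only [h1]
  rw [sum_comm]
  refine sum_congr rfl fun θ _ => ?_
  rw [← sum_filter, sum_const, nsmul_eq_mul, mul_comm, heads]
  congr 3
  ext j
  simp [sizeGE]
  tauto

/-- Dropping at most k jobs lowers each threshold count by at most k. With the next lemma, `excess`
is the minimum over all such deletions. -/
lemma excess_le_sum_sdiff (hδ : J.IsGaps δ) {k : ℕ} (B : Finset (Fin n)) {Z : Finset (Fin n)}
    (hZ : Z.card ≤ k) (ω : Fin n → Bool) :
    J.excess δ k B ω ≤ ∑ j ∈ B \ Z, J.procTime ω j := by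
  rw [sum_procTime_eq hδ]
  refine sum_le_sum fun θ _ => mul_le_mul_of_nonneg_left (Nat.cast_le.2 ?_) (hδ.1 θ)
  rw [tsub_le_iff_right]
  have h : (J.sizeGE θ ∩ B).filter (fun j => ω j = true) ⊆
      (J.sizeGE θ ∩ (B \ Z)).filter (fun j => ω j = true) ∪ Z := by
    intro j
    simp
    tauto
  exact (card_le_card h).trans ((card_union_le _ _).trans (by unfold heads; omega))

/-- Deleting the k longest heads lowers all threshold counts by k (down to 0) simultaneously. -/
lemma exists_sum_sdiff_le_excess (hδ : J.IsGaps δ) (k : ℕ) (B : Finset (Fin n))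
    (ω : Fin n → Bool) :
    ∃ Z : Finset (Fin n), Z.card ≤ k ∧ ∑ j ∈ B \ Z, J.procTime ω j ≤ J.excess δ k B ω := by
  obtain ⟨Z, hZ, h⟩ := exists_remove_largest J.size k (B.filter fun j => ω j = true)
  refine ⟨Z, hZ, ?_⟩
  rw [sum_procTime_eq hδ]
  refine sum_le_sum fun θ _ => mul_le_mul_of_nonneg_left (Nat.cast_le.2 ?_) (hδ.1 θ)
  have e1 : (J.sizeGE θ ∩ (B \ Z)).filter (fun j => ω j = true) =
      ((B.filter fun j => ω j = true) \ Z).filter fun j => θ ≤ J.size j := by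
    ext j
    simp [sizeGE]
    tauto
  have e2 : (J.sizeGE θ ∩ B).filter (fun j => ω j = true) =
      (B.filter fun j => ω j = true).filter fun j => θ ≤ J.size j := by
    ext j
    simp [sizeGE]
    tauto
  rw [heads, heads, e1, e2]
  exact h θ

/-! ### List schedules -/

/-- A machine that receives no job of `Z` is loaded only by jobs outside `Z`. -/
lemma listLoads_le_sum_sdiff {m : ℕ} [NeZero m] (σ : Equiv.Perm (Fin n)) (ω : Fin n → Bool)
    (Z : Finset (Fin n)) (i : Fin m) (t : ℕ)
    (h : ∀ u : Fin n, (u : ℕ) < t → leastLoaded (J.listLoads m σ ω u) = i → σ u ∉ Z) :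
    J.listLoads m σ ω t i ≤
      ∑ u ∈ univ.filter fun u : Fin n => (u : ℕ) < t ∧ σ u ∉ Z, J.procTime ω (σ u) := by
  induction t with
  | zero => simp [listLoads]
  | succ t ih =>
    have ih' := ih fun u hu => h u (hu.trans (Nat.lt_succ_self t))
    have hsub : (univ.filter fun u : Fin n => (u : ℕ) < t ∧ σ u ∉ Z) ⊆
        univ.filter fun u : Fin n => (u : ℕ) < t + 1 ∧ σ u ∉ Z := by
      intro u
      simp only [mem_filter, mem_univ, true_and]
      exact fun hu => ⟨by omega, hu.2⟩
    have hmono := sum_le_sum_of_subset_of_nonneg hsub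
      (f := fun u => J.procTime ω (σ u)) fun u _ _ => J.procTime_nonneg ω _
    simp only [listLoads]
    split_ifs with ht
    · by_cases hi : leastLoaded (J.listLoads m σ ω t) = i
      · have hZ := h ⟨t, ht⟩ (Nat.lt_succ_self t) hi
        have hins : (univ.filter fun u : Fin n => (u : ℕ) < t + 1 ∧ σ u ∉ Z) =
            insert ⟨t, ht⟩ (univ.filter fun u : Fin n => (u : ℕ) < t ∧ σ u ∉ Z) := by
          ext u
          simp only [mem_filter, mem_univ, true_and, mem_insert, Fin.ext_iff]
          constructor
          · rintro ⟨h1, h2⟩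
            by_cases hu : (u : ℕ) = t
            · exact Or.inl hu
            · exact Or.inr ⟨by omega, h2⟩
          · rintro (hu | ⟨h1, h2⟩)
            · have : u = ⟨t, ht⟩ := Fin.ext hu
              exact ⟨by omega, this ▸ hZ⟩
            · exact ⟨by omega, h2⟩
        rw [hins, sum_insert (by simp), hi, Function.update_self]
        linarith
      · rw [Function.update_of_ne (Ne.symm hi)]
        exact ih'.trans hmono
    · exact ih'.trans hmono

/-- If all the jobs before position `t` of the list belong to `B`, then some machine is free
when all of these jobs but the `m - 1` longest ones could have been processed. -/
lemma listSchedule_start_le_sum_sdiff {m : ℕ} [NeZero m] (σ : Equiv.Perm (Fin n))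
    (ω : Fin n → Bool) (t : Fin n) {B Z : Finset (Fin n)} (hB : ∀ u < t, σ u ∈ B)
    (hZ : Z.card ≤ m - 1) :
    (J.listSchedule m σ).start ω t ≤ ∑ j ∈ B \ Z, J.procTime ω j := by
  -- Pigeonhole: at most m - 1 machines receive a job of `Z`, so some machine receives none, and the
  -- least load is at most its load.
  have hlt : (Z.image fun j => leastLoaded (J.listLoads m σ ω (σ.symm j))).card <
      (univ : Finset (Fin m)).card := by
    rw [card_univ, Fintype.card_fin]
    have := NeZero.pos m
    exact (card_image_le.trans hZ).trans_lt (by omega)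
  obtain ⟨i, -, hi⟩ := exists_mem_notMem_of_card_lt_card hlt
  refine (leastLoaded_le _ i).trans ((J.listLoads_le_sum_sdiff σ ω Z i t ?_).trans ?_)
  · intro u _ hu hmem
    exact hi (mem_image.2 ⟨σ u, hmem, by simpa using hu⟩)
  · rw [← sum_image (g := σ) (f := fun j => J.procTime ω j) σ.injective.injOn]
    refine sum_le_sum_of_subset_of_nonneg ?_ fun j _ _ => J.procTime_nonneg ω j
    intro j hj
    obtain ⟨u, hu, rfl⟩ := mem_image.1 hj
    simp only [mem_filter, mem_univ, true_and] at hu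
    exact mem_sdiff.2 ⟨hB u hu.1, hu.2⟩

/-! ### Arbitrary policies -/

variable {m : ℕ} (P : J.AdaptivePolicy m)

/-- By strong induction applied to the last earlier job on the same machine. -/
lemma AdaptivePolicy.sum_same_machine_le (ω : Fin n → Bool) (t : Fin n) :
    ∑ u with u < t ∧ P.machine ω u = P.machine ω t, J.procTime ω (P.job ω u) ≤ P.start ω t := by
  induction t using WellFoundedLT.induction with
  | ind t ih =>
    rcases (univ.filter fun u => u < t ∧ P.machine ω u = P.machine ω t).eq_empty_or_nonempty
      with h | h
    · rw [h, sum_empty]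
      exact P.start_nonneg ω t
    · obtain ⟨v, hv, hmax⟩ := exists_max_image _ id h
      have hv' := (mem_filter.1 hv).2
      have hsub : (univ.filter fun u => u < t ∧ P.machine ω u = P.machine ω t) ⊆
          insert v (univ.filter fun u => u < v ∧ P.machine ω u = P.machine ω v) := by
        intro u hu
        have hu' := (mem_filter.1 hu).2
        rcases (hmax u hu).lt_or_eq with hlt | heq
        · exact mem_insert_of_mem
            (mem_filter.2 ⟨mem_univ _, hlt, hu'.2.trans hv'.2.symm⟩)
        · exact mem_insert.2 (Or.inl heq)
      refine (sum_le_sum_of_subset_of_nonneg hsub fun u _ _ => J.procTime_nonneg ω _).trans ?_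
      rw [sum_insert (by simp)]
      have h1 := ih v hv'.1
      have h2 := P.no_overlap ω t v hv'.1 hv'.2
      linarith

/-- When a job is started, all the jobs started before have been processed, except for at most
one job on every other machine. -/
lemma AdaptivePolicy.excess_started_le (hδ : J.IsGaps δ) (ω : Fin n → Bool) (t : Fin n) :
    J.excess δ (m - 1) (P.started t ω) ω ≤ m * P.start ω t := by
  -- The last job on each other machine: the only ones that may still be running.
  set I : Finset (Fin n) := univ.filter fun u => u < t ∧ P.machine ω u ≠ P.machine ω t ∧
    ∀ v < t, P.machine ω v = P.machine ω u → v ≤ u with hI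
  have hIcard : I.card ≤ m - 1 := by
    have := card_le_card_of_injOn (s := I) (t := univ.erase (P.machine ω t)) (P.machine ω) ?_ ?_
    · simpa using this
    · intro u hu
      have hu' := (mem_filter.1 hu).2
      exact mem_erase.2 ⟨hu'.2.1, mem_univ _⟩
    · intro u hu v hv huv
      have hu' := (mem_filter.1 hu).2
      have hv' := (mem_filter.1 hv).2
      exact le_antisymm (hv'.2.2 u hu'.1 huv) (hu'.2.2 v hv'.1 huv.symm)
  refine (excess_le_sum_sdiff hδ _ (Z := I.image (P.job ω)) (card_image_le.trans hIcard) ω).trans ?_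
  have himg : P.started t ω \ I.image (P.job ω) =
      ((univ.filter fun u => u < t) \ I).image (P.job ω) := by
    rw [image_sdiff _ _ (P.job ω).injective]
    rfl
  rw [himg, sum_image (P.job ω).injective.injOn,
    ← sum_fiberwise _ (P.machine ω) fun u => J.procTime ω (P.job ω u)]
  -- On another machine, all jobs but the last are finished when that last job starts, which is no
  -- later than decision `t`.
  have hmach : ∀ i : Fin m, ∑ u ∈ (univ.filter fun u => u < t) \ I with P.machine ω u = i,
      J.procTime ω (P.job ω u) ≤ P.start ω t := by
    intro i
    by_cases hi : i = P.machine ω t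
    · subst hi
      refine le_trans (sum_le_sum_of_subset_of_nonneg ?_ fun u _ _ => J.procTime_nonneg ω _)
        (P.sum_same_machine_le ω t)
      intro u
      simp only [mem_filter, mem_sdiff, mem_univ, true_and]
      exact fun h => ⟨h.1.1, h.2⟩
    · rcases (univ.filter fun u => u < t ∧ P.machine ω u = i).eq_empty_or_nonempty with h | h
      · rw [sum_eq_zero]
        · exact P.start_nonneg ω t
        · intro u hu
          simp only [mem_filter, mem_sdiff, mem_univ, true_and] at hu
          exact absurd (filter_eq_empty_iff.1 h (mem_univ u)) (not_not.2 ⟨hu.1.1, hu.2⟩)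
      · obtain ⟨v, hv, hmax⟩ := exists_max_image _ id h
        have hv' := (mem_filter.1 hv).2
        refine le_trans (sum_le_sum_of_subset_of_nonneg ?_ fun u _ _ => J.procTime_nonneg ω _)
          ((P.sum_same_machine_le ω v).trans (P.start_mono ω hv'.1.le))
        intro u hu
        simp only [mem_filter, mem_sdiff, mem_univ, true_and] at hu ⊢
        refine ⟨lt_of_le_of_ne (hmax u (by simp [hu.1.1, hu.2])) ?_, hu.2.trans hv'.2.symm⟩
        intro huv
        have huv' : u = v := huv
        refine hu.1.2 (mem_filter.2 ⟨mem_univ _, hu.1.1, by rwa [hu.2], fun w hw hwm => ?_⟩)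
        rw [huv']
        exact hmax w (by simp [hw, hwm, hu.2])
  refine (sum_le_sum fun i _ => hmach i).trans ?_
  simp

lemma AdaptivePolicy.mul_start_le (ω : Fin n → Bool) (t : Fin n) :
    ((n - t : ℕ) : ℝ) * P.start ω t ≤ ∑ u, P.start ω u := by
  have h1 : ∑ u ∈ Ici t, P.start ω t ≤ ∑ u ∈ Ici t, P.start ω u :=
    sum_le_sum fun u hu => P.start_mono ω (mem_Ici.1 hu)
  rw [sum_const, Fin.card_Ici, nsmul_eq_mul] at h1
  exact h1.trans (sum_le_sum_of_subset_of_nonneg (subset_univ _) fun u _ _ => P.start_nonneg ω u)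

end BernoulliJobs

end StochSched

namespace StochSched

open Finset

namespace BernoulliJobs

variable {n : ℕ} (J : BernoulliJobs n)

/-! ### The batches of StochFree -/

lemma topJobs_eq (r : Equiv.Perm (Fin n)) (s : ℝ) (q : ℕ) :
    J.topJobs r s q = topRanked r q (univ.filter fun j => J.size j = s) := by
  ext j
  simp only [topJobs, topRanked, mem_filter, mem_univ, true_and, filter_filter]

variable {J}

lemma mem_chooseJobs {r : Equiv.Perm (Fin n)} {k : ℕ} {j : Fin n} :
    j ∈ J.chooseJobs r k ↔
      n / 2 ^ k ≤ (univ.filter fun i => J.size i = J.size j ∧ r j < r i).card := by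
  simp only [chooseJobs, topJobs, mem_sdiff, mem_univ, true_and, mem_biUnion, mem_image,
    exists_exists_eq_and, mem_filter, not_exists, not_and, not_lt]
  exact ⟨fun h => h j rfl, fun h i hi => hi ▸ h⟩

lemma chooseJobs_mono (r : Equiv.Perm (Fin n)) : Monotone (J.chooseJobs r) := by
  intro k l hkl j hj
  rw [mem_chooseJobs] at hj ⊢
  exact (Nat.div_le_div_left (Nat.pow_le_pow_right two_pos hkl) (by positivity)).trans hj

lemma chooseJobs_zero (r : Equiv.Perm (Fin n)) : J.chooseJobs r 0 = ∅ := by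
  refine eq_empty_of_forall_notMem fun j hj => ?_
  rw [mem_chooseJobs, pow_zero, Nat.div_one] at hj
  refine absurd hj (not_le.2 ?_)
  have : (univ.filter fun i => J.size i = J.size j ∧ r j < r i).card <
      (univ : Finset (Fin n)).card :=
    card_lt_card ((ssubset_iff_of_subset (filter_subset _ _)).2 ⟨j, mem_univ j, by simp⟩)
  simpa using this

lemma card_sdiff_chooseJobs_le (r : Equiv.Perm (Fin n)) (k : ℕ) :
    (univ \ J.chooseJobs r k).card ≤ (univ.image J.size).card * (n / 2 ^ k) := by
  rw [chooseJobs, sdiff_sdiff_right_self]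
  refine (card_le_card inter_subset_right).trans (card_biUnion_le_card_mul _ _ _ fun s _ => ?_)
  rw [topJobs_eq]
  exact card_topRanked_le r _ _

/-- A job outranked by q jobs of its own size is a fortiori outranked by q jobs of size at least
`θ`. -/
lemma inter_chooseJobs_subset (r : Equiv.Perm (Fin n)) (k : ℕ) (θ : ℝ) :
    J.sizeGE θ ∩ J.chooseJobs r k ⊆
      J.sizeGE θ \ topRanked r (n / 2 ^ k) (J.sizeGE θ) := by
  intro j hj
  obtain ⟨h1, h2⟩ := mem_inter.1 hj
  refine mem_sdiff.2 ⟨h1, fun h => ?_⟩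
  rw [mem_chooseJobs] at h2
  refine absurd (mem_filter.1 h).2 (not_lt.2 (h2.trans (card_le_card fun i hi => ?_)))
  simp only [sizeGE, mem_filter, mem_univ, true_and] at h1 hi ⊢
  exact ⟨hi.1 ▸ h1, hi.2⟩

lemma exists_isProbRank (J : BernoulliJobs n) : ∃ r, J.IsProbRank r := by
  refine ⟨(Tuple.sort J.prob).symm, fun i j hij => ?_⟩
  by_contra h
  have := Tuple.monotone_sort J.prob (not_lt.1 h)
  simp at this
  linarith

lemma exists_isStochFreeList (J : BernoulliJobs n) : ∃ r σ, J.IsStochFreeList r σ := by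
  obtain ⟨r, hr⟩ := J.exists_isProbRank
  set missed : Fin n → Finset ℕ := fun j =>
    (Icc 1 (Nat.log 2 n)).filter fun k => j ∉ J.chooseJobs r k with hmissed
  -- As the J_k increase with k, the number of J_k missing a job determines its batch; ties are
  -- broken by size.
  set key : Fin n → ℕ ×ₗ ℝ := fun j => toLex ((missed j).card, J.size j) with hkey
  have hσ : ∀ i j, key i < key j → (Tuple.sort key).symm i < (Tuple.sort key).symm j := by
    intro i j hij
    by_contra h
    have := Tuple.monotone_sort key (not_lt.1 h)
    simp only [Function.comp_apply, Equiv.apply_symm_apply] at this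
    exact absurd hij (not_lt.2 this)
  refine ⟨r, Tuple.sort key, hr, fun k hk => ⟨fun i hi j hj => hσ i j ?_, fun i hi j hj hij =>
    hσ i j ?_⟩⟩
  · have hkj : k ∈ missed j := mem_filter.2 ⟨hk, hj⟩
    have hki : k ∉ missed i := fun h => (mem_filter.1 h).2 hi
    refine Prod.Lex.toLex_lt_toLex.2 (Or.inl ?_)
    refine card_lt_card ((ssubset_iff_of_subset ?_).2 ⟨k, hkj, hki⟩)
    intro l hl
    obtain ⟨h1, h2⟩ := mem_filter.1 hl
    refine mem_filter.2 ⟨h1, fun h => hj ?_⟩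
    have hlk : l ≤ k := by
      by_contra hlk
      exact h2 (chooseJobs_mono r (not_le.1 hlk).le hi)
    exact chooseJobs_mono r hlk h
  · have hmem : ∀ x ∈ J.chooseJobs r k \ J.chooseJobs r (k - 1), ∀ l,
        x ∈ J.chooseJobs r l ↔ k ≤ l := by
      intro x hx l
      obtain ⟨h1, h2⟩ := mem_sdiff.1 hx
      refine ⟨fun h => ?_, fun h => chooseJobs_mono r h h1⟩
      by_contra hkl
      exact h2 (chooseJobs_mono r (show l ≤ k - 1 by omega) h)
    refine Prod.Lex.toLex_lt_toLex.2 (Or.inr ⟨?_, hij⟩)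
    simp only [hmissed, hmem i hi, hmem j hj]

/-! ### The approximation guarantee -/

variable {δ : ℝ → ℝ} {m : ℕ} {r σ : Equiv.Perm (Fin n)}

lemma AdaptivePolicy.expect_excess_chooseJobs_le (P : J.AdaptivePolicy m) (hδ : J.IsGaps δ)
    (hr : J.IsProbRank r) (k : ℕ) :
    J.expect (J.excess δ (m - 1) (J.chooseJobs r k)) ≤
      J.expect fun ω => J.excess δ (m - 1) (P.started (n - n / 2 ^ k) ω) ω := by
  unfold excess
  rw [expect_sum, expect_sum]
  refine sum_le_sum fun θ _ => ?_
  rw [expect_const_mul, expect_const_mul]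
  refine mul_le_mul_of_nonneg_left ?_ (hδ.1 θ)
  have hf : Monotone fun x : ℕ => ((x - (m - 1) : ℕ) : ℝ) :=
    fun x y hxy => Nat.cast_le.2 (Nat.sub_le_sub_right hxy _)
  exact (J.expect_mono fun ω => hf (heads_mono (inter_chooseJobs_subset r k θ) ω)).trans
    (P.expect_heads_le hf hr _ _)

/-- The last ⌊n/2^k⌋ decisions all wait until the excess of the earlier jobs, divided by m, has
elapsed. -/
lemma AdaptivePolicy.mul_expect_excess_le (P : J.AdaptivePolicy m) (hδ : J.IsGaps δ)
    (hr : J.IsProbRank r) {k : ℕ} (hk : 0 < n / 2 ^ k) :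
    ((n / 2 ^ k : ℕ) : ℝ) * J.expect (J.excess δ (m - 1) (J.chooseJobs r k)) ≤
      m * J.expect fun ω => ∑ t, P.start ω t := by
  have hq : n / 2 ^ k ≤ n := Nat.div_le_self _ _
  refine (mul_le_mul_of_nonneg_left (P.expect_excess_chooseJobs_le hδ hr k)
    (Nat.cast_nonneg _)).trans ?_
  rw [← expect_const_mul, ← expect_const_mul]
  refine J.expect_mono fun ω => ?_
  have h1 := P.excess_started_le hδ ω ⟨n - n / 2 ^ k, by omega⟩
  have h2 := P.mul_start_le ω ⟨n - n / 2 ^ k, by omega⟩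
  simp only [Nat.sub_sub_self hq] at h2
  calc _ ≤ ((n / 2 ^ k : ℕ) : ℝ) * (m * P.start ω ⟨n - n / 2 ^ k, by omega⟩) :=
        mul_le_mul_of_nonneg_left h1 (Nat.cast_nonneg _)
    _ = m * (((n / 2 ^ k : ℕ) : ℝ) * P.start ω ⟨n - n / 2 ^ k, by omega⟩) := by ring
    _ ≤ _ := mul_le_mul_of_nonneg_left h2 (Nat.cast_nonneg _)

lemma AdaptivePolicy.cost_eq (P : J.AdaptivePolicy m) :
    P.cost = J.expect (fun ω => ∑ t, P.start ω t) + J.expect fun ω => ∑ j, J.procTime ω j := by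
  rw [← expect_add, cost]
  congr 1
  funext ω
  rw [sum_add_distrib, Equiv.sum_comp (P.job ω) fun j => J.procTime ω j]

variable [NeZero m]

lemma IsStochFreeList.start_le_of_mem (h : J.IsStochFreeList r σ) (hδ : J.IsGaps δ) {k : ℕ}
    (hk : k ∈ Icc 1 (Nat.log 2 n)) {t : Fin n} (ht : σ t ∈ J.chooseJobs r k)
    (ω : Fin n → Bool) :
    (J.listSchedule m σ).start ω t ≤ J.excess δ (m - 1) (J.chooseJobs r k) ω := by
  obtain ⟨Z, hZ, hle⟩ := exists_sum_sdiff_le_excess hδ (m - 1) (J.chooseJobs r k) ω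
  refine (listSchedule_start_le_sum_sdiff σ ω t (fun u hu => ?_) hZ).trans hle
  by_contra hmem
  have := (h.2 k hk).1 _ ht _ hmem
  simp at this
  exact absurd this (not_lt.2 hu.le)

/-- A crude bound for the jobs left after all batches: everything outside `B` is charged the total
processing time. -/
lemma listSchedule_start_le (hδ : J.IsGaps δ) (B : Finset (Fin n)) (t : Fin n)
    (ω : Fin n → Bool) :
    (J.listSchedule m σ).start ω t ≤ J.excess δ (m - 1) B ω + ∑ j, J.procTime ω j := by
  obtain ⟨Z, hZ, hle⟩ := exists_sum_sdiff_le_excess hδ (m - 1) B ω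
  refine (listSchedule_start_le_sum_sdiff σ ω t (B := univ) (fun _ _ => mem_univ _) hZ).trans ?_
  have hsub : univ \ Z ⊆ (B \ Z) ∪ (univ \ B) := by
    intro j
    simp
    tauto
  have hnn : ∀ j, 0 ≤ J.procTime ω j := J.procTime_nonneg ω
  calc _ ≤ ∑ j ∈ (B \ Z) ∪ (univ \ B), J.procTime ω j :=
        sum_le_sum_of_subset_of_nonneg hsub fun j _ _ => hnn j
    _ ≤ ∑ j ∈ B \ Z, J.procTime ω j + ∑ j ∈ univ \ B, J.procTime ω j := by
        rw [← sum_union_inter]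
        exact le_add_of_nonneg_right (sum_nonneg fun j _ => hnn j)
    _ ≤ _ := add_le_add hle (sum_le_sum_of_subset_of_nonneg (subset_univ _) fun j _ _ => hnn j)

/-- Each job is charged to the first J_k containing it; being absent from J_{k-1}, it is counted in
the k-th summand. -/
lemma IsStochFreeList.sum_start_le (h : J.IsStochFreeList r σ) (hδ : J.IsGaps δ)
    (ω : Fin n → Bool) :
    ∑ t, (J.listSchedule m σ).start ω t ≤
      ∑ k ∈ Icc 1 (Nat.log 2 n), ((univ \ J.chooseJobs r (k - 1)).card : ℝ) *
        J.excess δ (m - 1) (J.chooseJobs r k) ω +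
      ((univ \ J.chooseJobs r (Nat.log 2 n)).card : ℝ) *
        (J.excess δ (m - 1) (J.chooseJobs r (Nat.log 2 n)) ω + ∑ j, J.procTime ω j) := by
  set E : ℕ → ℝ := fun k => J.excess δ (m - 1) (J.chooseJobs r k) ω with hE
  set X := ∑ j, J.procTime ω j with hX
  have hE0 : ∀ k, 0 ≤ E k := fun k => excess_nonneg hδ _ _ _
  have hX0 : 0 ≤ X := sum_nonneg fun j _ => J.procTime_nonneg ω j
  have hpt : ∀ j, (J.listSchedule m σ).start ω (σ.symm j) ≤
      ∑ k ∈ Icc 1 (Nat.log 2 n), (if j ∈ univ \ J.chooseJobs r (k - 1) then E k else 0) +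
        if j ∈ univ \ J.chooseJobs r (Nat.log 2 n) then E (Nat.log 2 n) + X else 0 := by
    intro j
    have hnn : ∀ k ∈ Icc 1 (Nat.log 2 n),
        0 ≤ if j ∈ univ \ J.chooseJobs r (k - 1) then E k else 0 := fun k _ => by
      split_ifs
      exacts [hE0 k, le_rfl]
    by_cases hj : j ∈ J.chooseJobs r (Nat.log 2 n)
    · classical
      have hex : ∃ k, j ∈ J.chooseJobs r k := ⟨_, hj⟩
      set k := Nat.find hex with hk
      have hjk : j ∈ J.chooseJobs r k := Nat.find_spec hex
      have hk0 : k ≠ 0 := by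
        intro h0
        rw [h0, chooseJobs_zero] at hjk
        simp at hjk
      have hkmem : k ∈ Icc 1 (Nat.log 2 n) :=
        mem_Icc.2 ⟨Nat.one_le_iff_ne_zero.2 hk0, Nat.find_min' hex hj⟩
      have hprev : j ∈ univ \ J.chooseJobs r (k - 1) :=
        mem_sdiff.2 ⟨mem_univ j, Nat.find_min hex (by omega)⟩
      have h1 : (J.listSchedule m σ).start ω (σ.symm j) ≤ E k :=
        h.start_le_of_mem hδ hkmem (by simpa using hjk) ω
      have h2 := single_le_sum hnn hkmem
      rw [if_pos hprev] at h2
      simp only [mem_sdiff, hj, not_true, and_false, if_false, add_zero]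
      simp only [mem_sdiff] at h2
      exact h1.trans h2
    · rw [if_pos (mem_sdiff.2 ⟨mem_univ j, hj⟩)]
      exact (listSchedule_start_le hδ _ _ ω).trans (le_add_of_nonneg_left (sum_nonneg hnn))
  rw [← Equiv.sum_comp σ.symm]
  refine (sum_le_sum fun j _ => hpt j).trans (le_of_eq ?_)
  rw [sum_add_distrib, sum_comm]
  simp only [← sum_filter, sum_const, nsmul_eq_mul, filter_mem_eq_inter, univ_inter, hE, hX]

/-- StochFree is an `O(m L log n)`-approximation for jobs with `L` distinct sizes. -/
lemma IsStochFreeList.cost_le (h : J.IsStochFreeList r σ) (hm : 2 ≤ m) (hn : 0 < n)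
    (P : J.AdaptivePolicy m) :
    (J.listSchedule m σ).cost ≤
      3 * m * (1 + Nat.log 2 n) * (univ.image J.size).card * P.cost := by
  obtain ⟨δ, hδ⟩ := J.exists_isGaps
  set K := Nat.log 2 n with hK
  set L : ℝ := ((univ.image J.size).card : ℝ) with hL
  have hL1 : 1 ≤ L := by
    have : (univ.image J.size).Nonempty := ⟨_, mem_image_of_mem _ (mem_univ ⟨0, hn⟩)⟩
    exact Nat.one_le_cast.2 this.card_pos
  set E : ℕ → ℝ := fun k => J.expect (J.excess δ (m - 1) (J.chooseJobs r k)) with hE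
  set X : ℝ := J.expect fun ω => ∑ j, J.procTime ω j with hX
  set S : ℝ := J.expect fun ω => ∑ t, P.start ω t with hS
  have hE0 : ∀ k, 0 ≤ E k := fun k => J.expect_nonneg (excess_nonneg hδ _ _)
  have hX0 : 0 ≤ X := J.expect_nonneg fun ω => sum_nonneg fun j _ => J.procTime_nonneg ω j
  have hS0 : 0 ≤ S := J.expect_nonneg fun ω => sum_nonneg fun j _ => P.start_nonneg ω j
  have hq : ∀ k ≤ K, 0 < n / 2 ^ k := fun k hk =>
    Nat.div_pos (Nat.pow_le_of_le_log hn.ne' hk) (by positivity)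
  have hm2 : (2 : ℝ) ≤ m := by exact_mod_cast hm
  have hbatch : ∀ k ∈ Icc 1 K, ((univ \ J.chooseJobs r (k - 1)).card : ℝ) * E k ≤
      3 * L * (m * S) := by
    intro k hk
    obtain ⟨hk1, hkK⟩ := mem_Icc.1 hk
    have hcard : ((univ \ J.chooseJobs r (k - 1)).card : ℝ) ≤ 3 * L * (n / 2 ^ k : ℕ) := by
      have h1 := card_sdiff_chooseJobs_le (J := J) r (k - 1)
      -- If ⌊x/2⌋ ≥ 1, then x ≤ 2⌊x/2⌋ + 1 ≤ 3⌊x/2⌋.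
      have h2 : n / 2 ^ (k - 1) ≤ 3 * (n / 2 ^ k) := by
        have h3 := hq k hkK
        have h4 : n / 2 ^ k = n / 2 ^ (k - 1) / 2 := by
          rw [Nat.div_div_eq_div_mul, ← pow_succ, Nat.sub_add_cancel hk1]
        omega
      have h5 := h1.trans (Nat.mul_le_mul_left _ h2)
      calc ((univ \ J.chooseJobs r (k - 1)).card : ℝ)
          ≤ (((univ.image J.size).card * (3 * (n / 2 ^ k)) : ℕ) : ℝ) := Nat.cast_le.2 h5
        _ = 3 * L * (n / 2 ^ k : ℕ) := by push_cast; ring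
    calc _ ≤ 3 * L * (n / 2 ^ k : ℕ) * E k := mul_le_mul_of_nonneg_right hcard (hE0 k)
      _ = 3 * L * (((n / 2 ^ k : ℕ) : ℝ) * E k) := by ring
      _ ≤ _ := mul_le_mul_of_nonneg_left (P.mul_expect_excess_le hδ h.1 (hq k hkK))
        (by positivity)
  -- After the last batch only one job per size is left over.
  have hqK : n / 2 ^ K = 1 := by
    have h1 := hq K le_rfl
    have h2 : n / 2 ^ K < 2 := by
      rw [Nat.div_lt_iff_lt_mul (by positivity), mul_comm, ← pow_succ]
      exact Nat.lt_pow_succ_log_self one_lt_two n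
    omega
  have hrest : ((univ \ J.chooseJobs r K).card : ℝ) ≤ L := by
    have := card_sdiff_chooseJobs_le (J := J) r K
    rw [hqK, mul_one] at this
    exact Nat.cast_le.2 this
  have hEK : E K ≤ m * S := by
    have := P.mul_expect_excess_le hδ h.1 (hq K le_rfl)
    rwa [hqK, Nat.cast_one, one_mul] at this
  have hstart : J.expect (fun ω => ∑ t, (J.listSchedule m σ).start ω t) ≤
      K * (3 * L * (m * S)) + L * (m * S + X) := by
    refine (J.expect_mono fun ω => h.sum_start_le hδ ω).trans ?_
    rw [expect_add, expect_sum, expect_const_mul, expect_add]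
    refine add_le_add ?_ ?_
    · have := sum_le_sum hbatch
      rw [sum_const, Nat.card_Icc, Nat.add_sub_cancel, nsmul_eq_mul] at this
      refine le_trans (le_of_eq (sum_congr rfl fun k _ => ?_)) this
      rw [expect_const_mul]
    · exact mul_le_mul hrest (add_le_add hEK le_rfl) (add_nonneg (hE0 K) hX0) (by positivity)
  rw [AdaptivePolicy.cost_eq, P.cost_eq]
  -- Here m ≥ 2 and L ≥ 1 absorb the algorithm's own processing time.
  have hLX : X + L * X ≤ L * m * X := by
    nlinarith [mul_nonneg (mul_nonneg (by linarith : 0 ≤ L) (by linarith : (0 : ℝ) ≤ m - 2)) hX0,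
      mul_nonneg (by linarith : 0 ≤ L - 1) hX0]
  have hK0 : (0 : ℝ) ≤ K := Nat.cast_nonneg K
  have hLmS : 0 ≤ L * m * S := by positivity
  have hLmX : 0 ≤ L * m * X := by positivity
  have hKLmX : 0 ≤ K * (L * m * X) := by positivity
  change J.expect (fun ω => ∑ t, (J.listSchedule m σ).start ω t) + X ≤
    3 * m * (1 + K) * L * (S + X)
  nlinarith

end BernoulliJobs

end StochSched

theorem lemma4p6 :
    ∃ c : ℕ, ∀ A : ℝ, 0 < A → ∃ C : ℝ, 0 < C ∧
      ∀ (m n : ℕ) [NeZero m] (J : StochSched.BernoulliJobs n), 2 ≤ m → J.Rescaled A →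
        (∃ r σ : Equiv.Perm (Fin n), J.IsStochFreeList r σ) ∧
        ∀ r σ : Equiv.Perm (Fin n), J.IsStochFreeList r σ →
          ∀ P : J.AdaptivePolicy m,
            (J.listSchedule m σ).cost ≤ C * m * (1 + Real.logb 2 n) ^ c * P.cost := by
  -- One logarithm comes from the number of batches, the other from the number of sizes.
  refine ⟨2, fun A hA => ⟨3 * A, by positivity, fun m n _ J hm hJ =>
    ⟨J.exists_isStochFreeList, fun r σ h P => ?_⟩⟩⟩
  rcases Nat.eq_zero_or_pos n with rfl | hn
  · simp [StochSched.BernoulliJobs.AdaptivePolicy.cost, StochSched.BernoulliJobs.expect]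
  have hcost : 0 ≤ P.cost := J.expect_nonneg fun ω => Finset.sum_nonneg fun t _ =>
    add_nonneg (P.start_nonneg ω t) (J.procTime_nonneg ω _)
  have hlog : (Nat.log 2 n : ℝ) ≤ Real.logb 2 n := by
    exact_mod_cast Real.natLog_le_logb n 2
  have h0 : (0 : ℝ) ≤ Nat.log 2 n := Nat.cast_nonneg _
  refine (h.cost_le hm hn P).trans (mul_le_mul_of_nonneg_right ?_ hcost)
  calc 3 * (m : ℝ) * (1 + Nat.log 2 n) * ((Finset.univ.image J.size).card : ℝ)
      ≤ 3 * m * (1 + Real.logb 2 n) * (A * (1 + Real.logb 2 n)) := by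
        refine mul_le_mul (mul_le_mul_of_nonneg_left (by linarith) (by positivity)) hJ.1
          (Nat.cast_nonneg _) (mul_nonneg (by positivity) (by linarith))
    _ = 3 * A * m * (1 + Real.logb 2 n) ^ 2 := by ring
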